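/- Let $\Omega\in\mathbb{R}$ (in applications $\Omega>0$), and let $\mathrm{PW}_\Omega$ be the space of functions $g:\mathbb{R}\to\mathbb{C}$ (real-valued ones included) that belong to $L^2(\mathbb{R})$ and whose $L^2$ Fourier transform $\hat g(\omega)$, in the angular frequency $\omega$ (kernel $e^{-i\omega t}$), vanishes for almost every $\omega$ with $|\omega|>\Omega$. Let $N\ge 1$ be an integer and $T>0$, let $g\in\mathrm{PW}_\Omega$ be $N$ times continuously differentiable, and put $\gamma[k]=g(kT)$ for $k\in\mathbb{Z}$. Let $(\Delta x)[k]=x[k+1]-x[k]$ and let $\Delta^N$ be the $N$-fold iterate of $\Delta$. Then $g$ and $\Delta^N\gamma$ are bounded, and $$\|\Delta^N\gamma\|_\infty\;\le\;(T\Omega)^N\,\|g\|_\infty,$$ where $\|g\|_\infty=\sup_{t\in\mathbb{R}}|g(t)|$ and $\|\Delta^N\gamma\|_\infty=\sup_{k\in\mathbb{Z}}|(\Delta^N\gamma)[k]|$. -/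

import Mathlib

open MeasureTheory Set
open scoped FourierTransform

noncomputable section

/-- The space of finite-energy signals `g` on the real line that are bandlimited to `Ω` rad/s:
`g` is in `L²`, and its `L²` (Plancherel) Fourier transform vanishes almost everywhere at the
angular frequencies `ω` with `|ω| > Ω`. Mathlib's transform `𝓕` uses the kernel
`exp (-2πi ξ t)`, so that the ordinary frequency `ξ` is the angular frequency `ω = 2πξ`. -/
def PaleyWiener (Ω : ℝ) : Set (ℝ → ℂ) :=
  {g | ∃ hg : MemLp g 2 (volume : Measure ℝ),
    ∀ᵐ ξ : ℝ, Ω < |2 * Real.pi * ξ| → (𝓕 (hg.toLp g) : Lp ℂ 2 (volume : Measure ℝ)) ξ = 0}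

/-- The samples `γ[k] = g (kT)`, `k ∈ ℤ`. -/
def samples (g : ℝ → ℂ) (T : ℝ) : ℤ → ℂ := fun k => g (k * T)

/-- The `N`-th forward difference of a two-sided sequence, the `N`-fold iterate of
`(Δγ)[k] = γ[k+1] - γ[k]`. -/
def iterDiff (N : ℕ) (γ : ℤ → ℂ) : ℤ → ℂ := (fwdDiff (1 : ℤ))^[N] γ

/-- The supremum norm of a function; it is meaningful for bounded functions only. -/
def supNorm {α : Type*} (f : α → ℂ) : ℝ := ⨆ a, ‖f a‖

/-- `f` is bounded, that is, the supremum that defines its supremum norm is finite. -/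
def BoundedFun {α : Type*} (f : α → ℂ) : Prop := BddAbove (range fun a => ‖f a‖)

end

/-!
The inequality is Bernstein's inequality `‖g'‖_∞ ≤ Ω ‖g‖_∞` for bandlimited functions, applied `N`
times to successive differences.

A continuous `g` in the Paley-Wiener space is, at every point, the Fourier integral of an integrable
function `H` that vanishes off the band (`exists_integrable_fourier_eq`); in particular `g` is
bounded. If `Ω ≤ 0` then `H = 0` almost everywhere and `g = 0`. If `Ω > 0`, then differentiating
under the integral multiplies `H ξ` by `i ω`, with `ω = -2πξ`. On the band `|ω| ≤ Ω` the
factor `ω` agrees with a triangle wave of period `4Ω`, whose Fourier series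
(`hasSum_odd_exp_eq_mul_I`, from Mathlib's series for the second Bernoulli polynomial) converges
absolutely. Integrating it term by term gives the interpolation formula of M. Riesz and Boas,
which writes `g' t` as a sum of values `g (t ± (2k+1)π/(2Ω))` with coefficients whose absolute
values add up to `Ω`, whence Bernstein's inequality (`exists_hasDerivAt_fourier_norm_le`). By
the mean value inequality one difference with step `T` costs a factor `TΩ`. The difference is again
the Fourier integral of an integrable function on the same band (`fwdDiff_fourier`), so the estimate
iterates. Finally, differences of the samples are samples of the differences.
-/

open scoped SchwartzMap ContDiff

/-! ### The Fourier series of a triangle wave -/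

theorem hasSum_cos_div_sq {x : ℝ} (hx : x ∈ Icc (0 : ℝ) 1) :
    HasSum (fun n : ℕ => 1 / (n : ℝ) ^ 2 * Real.cos (2 * Real.pi * n * x))
      (Real.pi ^ 2 * (x ^ 2 - x + 1 / 6)) := by
  have h := hasSum_one_div_nat_pow_mul_cos one_ne_zero hx
  have h2 : (Polynomial.map (algebraMap ℚ ℝ) (Polynomial.bernoulli (2 * 1))).eval x
      = x ^ 2 - x + 6⁻¹ := bernoulliFun_two x
  rw [h2] at h
  convert h using 1
  norm_num [Nat.factorial]
  ring

/-- The odd-index part of the cosine series of `x ^ 2 - x + 1 / 6` is affine on half a period: the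
even-index terms form the same series at `2 * x`, divided by `4`. -/
theorem hasSum_odd_cos_div_sq {x : ℝ} (hx : x ∈ Icc (0 : ℝ) (1 / 2)) :
    HasSum (fun k : ℕ => 1 / (2 * k + 1 : ℝ) ^ 2 * Real.cos (2 * Real.pi * (2 * k + 1) * x))
      (Real.pi ^ 2 * (1 / 8 - x / 2)) := by
  have hall := hasSum_cos_div_sq (x := x) ⟨hx.1, by linarith [hx.2]⟩
  have heven := (hasSum_cos_div_sq (x := 2 * x)
    ⟨by linarith [hx.1], by linarith [hx.2]⟩).mul_left (1 / 4)
  have hodd := (hall.summable.comp_injective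
    (i := fun k : ℕ => 2 * k + 1) (fun a b h => by simpa using h)).hasSum
  have hsplit := HasSum.even_add_odd (f := fun n : ℕ =>
      1 / (n : ℝ) ^ 2 * Real.cos (2 * Real.pi * n * x))
    (heven.congr_fun (fun k => by
      push_cast
      rw [show 2 * Real.pi * (2 * k) * x = 2 * Real.pi * k * (2 * x) by ring]
      ring)) hodd
  have := hsplit.unique hall
  rw [← eq_sub_iff_add_eq'] at this
  rw [this, show Real.pi ^ 2 * (x ^ 2 - x + 1 / 6) -
    1 / 4 * (Real.pi ^ 2 * ((2 * x) ^ 2 - 2 * x + 1 / 6)) = Real.pi ^ 2 * (1 / 8 - x / 2) by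
      ring] at hodd
  exact hodd.congr_fun fun k => by simp

/-- On half a period around `0` the identity function agrees with a triangle wave of period `2 * π`.
Its Fourier series, times `I`, is written with exponentials in `y`; the phases
`I * exp (± (2 * k + 1) * (π / 2) * I)` are the signs `∓ (-1) ^ k` of the sine series, kept in this
form since only their modulus `1` matters. -/
theorem hasSum_odd_exp_eq_mul_I {y : ℝ} (hy : |y| ≤ Real.pi / 2) :
    HasSum (fun k : ℕ => ((2 / Real.pi / (2 * k + 1) ^ 2 : ℝ) : ℂ) *
      (Complex.I * Complex.exp (((2 * k + 1) * (Real.pi / 2) : ℝ) * Complex.I) *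
          Complex.exp ((-((2 * k + 1) * y) : ℝ) * Complex.I) +
        Complex.I * Complex.exp ((-((2 * k + 1) * (Real.pi / 2)) : ℝ) * Complex.I) *
          Complex.exp (((2 * k + 1) * y : ℝ) * Complex.I))) (y * Complex.I) := by
  have hpi := Real.pi_pos
  obtain ⟨h1, h2⟩ := abs_le.1 hy
  -- With `2πx = π / 2 - y`, the odd-index cosines in `x` become sines in `y`.
  have h := hasSum_odd_cos_div_sq (x := (Real.pi / 2 - y) / (2 * Real.pi))
    ⟨by apply div_nonneg <;> linarith, by rw [div_le_iff₀ (by positivity)]; linarith⟩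
  have h' := (Complex.hasSum_ofReal.2 (h.mul_left (4 / Real.pi))).mul_right Complex.I
  have hval :
      4 / Real.pi * (Real.pi ^ 2 * (1 / 8 - (Real.pi / 2 - y) / (2 * Real.pi) / 2)) = y := by
    field_simp
    ring
  rw [hval] at h'
  refine h'.congr_fun fun k => ?_
  have e : 2 * Real.pi * (2 * k + 1) * ((Real.pi / 2 - y) / (2 * Real.pi))
      = (2 * k + 1) * (Real.pi / 2) - (2 * k + 1) * y := by field_simp
  rw [e, mul_assoc Complex.I, mul_assoc Complex.I, ← Complex.exp_add, ← Complex.exp_add]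
  simp only [Complex.ofReal_mul, Complex.ofReal_cos, Complex.cos]
  push_cast
  ring_nf

/-! ### Bernstein's inequality -/

theorem integrable_exp_ofReal_mul_I_mul {H : ℝ → ℂ} (hH : Integrable H) {θ : ℝ → ℝ}
    (hθ : Continuous θ) :
    Integrable fun ξ => Complex.exp ((θ ξ : ℂ) * Complex.I) * H ξ := by
  refine hH.bdd_mul (c := 1) (Continuous.aestronglyMeasurable (by fun_prop)) ?_
  exact Filter.Eventually.of_forall fun ξ => (Complex.norm_exp_ofReal_mul_I _).le

/-- Bernstein's inequality for the Fourier integral of an integrable function that vanishes off the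
band `|2 * π * ξ| ≤ Ω`, by the interpolation formula of M. Riesz and Boas. -/
theorem exists_hasDerivAt_fourier_norm_le {Ω : ℝ} (hΩ : 0 < Ω) {H : ℝ → ℂ} (hH : Integrable H)
    (hsupp : ∀ᵐ ξ : ℝ, Ω < |2 * Real.pi * ξ| → H ξ = 0) {C : ℝ} (hC : ∀ t, ‖𝓕 H t‖ ≤ C)
    (t : ℝ) : ∃ d, HasDerivAt (𝓕 H) d t ∧ ‖d‖ ≤ Ω * C := by
  have hpi := Real.pi_pos
  have hxH : Integrable fun ξ : ℝ => ξ • H ξ := by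
    refine (hH.norm.const_mul (Ω / (2 * Real.pi))).mono'
      (continuous_id.aestronglyMeasurable.smul hH.aestronglyMeasurable) ?_
    filter_upwards [hsupp] with ξ hξ
    rw [norm_smul]
    rcases lt_or_ge Ω |2 * Real.pi * ξ| with h | h
    · simp [hξ h]
    · gcongr
      rw [le_div_iff₀ (by positivity), Real.norm_eq_abs]
      rwa [abs_mul, abs_of_pos (by positivity : 0 < 2 * Real.pi), mul_comm] at h
  refine ⟨_, Real.hasDerivAt_fourier hH hxH t, ?_⟩
  -- With `y = -2πξδ`, the band is exactly the interval `|y| ≤ π / 2` of the triangle wave.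
  set δ : ℝ := Real.pi / (2 * Ω) with hδ
  let c : ℕ → ℝ := fun k => 2 / Real.pi / (2 * k + 1) ^ 2
  let u : ℕ → ℂ := fun k => Complex.I * Complex.exp (((2 * k + 1) * (Real.pi / 2) : ℝ) * Complex.I)
  let v : ℕ → ℂ := fun k =>
    Complex.I * Complex.exp ((-((2 * k + 1) * (Real.pi / 2)) : ℝ) * Complex.I)
  have hc0 : ∀ k, 0 ≤ c k := fun k => by positivity
  have hu : ∀ k, ‖u k‖ = 1 := fun k => by
    rw [norm_mul, Complex.norm_exp_ofReal_mul_I, Complex.norm_I, one_mul]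
  have hv : ∀ k, ‖v k‖ = 1 := fun k => by
    rw [norm_mul, Complex.norm_exp_ofReal_mul_I, Complex.norm_I, one_mul]
  have hcsum : HasSum c (Real.pi / 4) := by
    have h := (hasSum_odd_cos_div_sq (x := 0) ⟨le_rfl, by norm_num⟩).mul_left (2 / Real.pi)
    rw [show 2 / Real.pi * (Real.pi ^ 2 * (1 / 8 - 0 / 2)) = Real.pi / 4 by
      field_simp; norm_num] at h
    exact h.congr_fun fun k => by simp [c, div_eq_mul_inv]
  let e : ℝ → ℝ → ℂ := fun s ξ => Complex.exp ((-2 * Real.pi * ξ * s : ℝ) * Complex.I) * H ξ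
  have he : ∀ s, Integrable (e s) := fun s => integrable_exp_ofReal_mul_I_mul hH (by fun_prop)
  have hFe : ∀ s, 𝓕 H s = ∫ ξ, e s ξ := fun s => by
    rw [Real.fourier_real_eq_integral_exp_smul]; rfl
  have hne : ∀ s ξ, ‖e s ξ‖ = ‖H ξ‖ := fun s ξ => by
    rw [norm_mul, Complex.norm_exp_ofReal_mul_I, one_mul]
  -- Integrate the triangle wave series against `e t`, term by term; multiplying `e t` by
  -- `exp (± (2k+1) y I)` shifts `t` by `± (2k+1) δ`.
  have hsum := hasSum_integral_of_dominated_convergence (μ := volume)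
    (F := fun (k : ℕ) ξ => (c k : ℂ) * (u k * e (t - (2 * k + 1) * δ) ξ
      + v k * e (t + (2 * k + 1) * δ) ξ))
    (f := fun ξ => ((-2 * Real.pi * ξ * δ : ℝ) * Complex.I) * e t ξ)
    (fun k ξ => c k * (2 * ‖H ξ‖))
    (fun k => ((((he _).const_mul _).add ((he _).const_mul _)).const_mul _).aestronglyMeasurable)
    (fun k => Filter.Eventually.of_forall fun ξ => by
      rw [norm_mul, Complex.norm_real, Real.norm_of_nonneg (hc0 k)]
      gcongr
      refine (norm_add_le _ _).trans_eq ?_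
      rw [norm_mul (u k), norm_mul (v k), hu, hv, hne, hne]; ring)
    (Filter.Eventually.of_forall fun ξ => hcsum.summable.mul_right _)
    (by simpa only [tsum_mul_right] using (hH.norm.const_mul 2).const_mul _)
    (by
      filter_upwards [hsupp] with ξ hξ
      rcases lt_or_ge Ω |2 * Real.pi * ξ| with h | h
      · simp [e, hξ h]
      · have hy : |-2 * Real.pi * ξ * δ| ≤ Real.pi / 2 := by
          rw [show -2 * Real.pi * ξ * δ = -(2 * Real.pi * ξ) * δ by ring, abs_mul, abs_neg,
            abs_of_pos (by positivity : 0 < δ)]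
          calc |2 * Real.pi * ξ| * δ ≤ Ω * δ := by gcongr
            _ = Real.pi / 2 := by rw [hδ]; field_simp
        refine ((hasSum_odd_exp_eq_mul_I hy).mul_right (e t ξ)).congr_fun fun k => ?_
        have e1 : e (t - (2 * k + 1) * δ) ξ = Complex.exp
            ((-((2 * k + 1) * (-2 * Real.pi * ξ * δ)) : ℝ) * Complex.I) * e t ξ := by
          simp only [e]
          rw [← mul_assoc, ← Complex.exp_add]
          push_cast; ring_nf
        have e2 : e (t + (2 * k + 1) * δ) ξ = Complex.exp
            (((2 * k + 1) * (-2 * Real.pi * ξ * δ) : ℝ) * Complex.I) * e t ξ := by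
          simp only [e]
          rw [← mul_assoc, ← Complex.exp_add]
          push_cast; ring_nf
        rw [e1, e2]
        simp only [c, u, v]
        ring)
  have hterm : ∀ k : ℕ, ∫ ξ, (c k : ℂ) * (u k * e (t - (2 * k + 1) * δ) ξ
      + v k * e (t + (2 * k + 1) * δ) ξ)
      = c k * (u k * 𝓕 H (t - (2 * k + 1) * δ) + v k * 𝓕 H (t + (2 * k + 1) * δ)) := fun k => by
    rw [integral_const_mul, integral_add ((he _).const_mul _) ((he _).const_mul _),
      integral_const_mul, integral_const_mul, hFe, hFe]
  simp only [hterm] at hsum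
  have hbound : ‖∫ ξ, ((-2 * Real.pi * ξ * δ : ℝ) * Complex.I) * e t ξ‖ ≤
      Real.pi / 4 * (2 * C) := by
    refine hsum.norm_le_of_bounded (hcsum.mul_right (2 * C)) fun k => ?_
    rw [norm_mul, Complex.norm_real, Real.norm_of_nonneg (hc0 k)]
    refine mul_le_mul_of_nonneg_left ((norm_add_le _ _).trans ?_) (hc0 k)
    rw [norm_mul (u k), norm_mul (v k), hu, hv, one_mul, one_mul]
    linarith [hC (t - (2 * k + 1) * δ), hC (t + (2 * k + 1) * δ)]
  have hd : 𝓕 (fun ξ : ℝ => (-2 * Real.pi * Complex.I * ξ) • H ξ) t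
      = ((2 * Ω / Real.pi : ℝ) : ℂ) * ∫ ξ, ((-2 * Real.pi * ξ * δ : ℝ) * Complex.I) * e t ξ := by
    rw [← integral_const_mul, Real.fourier_real_eq_integral_exp_smul]
    congr 1
    ext ξ
    have hδ' : (2 * Ω / Real.pi : ℝ) * δ = 1 := by rw [hδ]; field_simp
    have hδ'' : ((2 * Ω / Real.pi : ℝ) : ℂ) * (δ : ℂ) = 1 := by exact_mod_cast hδ'
    simp only [e, smul_eq_mul]
    push_cast at hδ'' ⊢
    linear_combination (-(Complex.exp (-2 * Real.pi * ξ * t * Complex.I) *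
      (-2 * Real.pi * Complex.I * ξ) * H ξ)) * hδ''
  rw [hd, norm_mul, Complex.norm_real, Real.norm_of_nonneg (by positivity)]
  calc 2 * Ω / Real.pi * _ ≤ 2 * Ω / Real.pi * (Real.pi / 4 * (2 * C)) := by gcongr
    _ = Ω * C := by field_simp; ring

/-! ### Paley-Wiener functions as Fourier integrals -/

theorem continuous_fourierInv_of_integrable {f : ℝ → ℂ} (hf : Integrable f) :
    Continuous (𝓕⁻ f) := by
  rw [Real.fourierInv_eq_fourier_comp_neg]
  exact VectorFourier.fourierIntegral_continuous Real.continuous_fourierChar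
    continuous_inner hf.comp_neg

/-- The inverse `L²` Fourier transform of an integrable `F` is the Fourier integral. Both are tested
against smooth functions of compact support: the `L²` transform agrees with that of tempered
distributions, and the Fourier integral is self-adjoint by Fubini's theorem. -/
theorem coeFn_fourierInv_ae_eq (F : Lp ℂ 2 (volume : Measure ℝ))
    (hF : Integrable (F : ℝ → ℂ)) :
    ((𝓕⁻ F : Lp ℂ 2 (volume : Measure ℝ)) : ℝ → ℂ) =ᵐ[volume] 𝓕⁻ (F : ℝ → ℂ) := by
  refine ae_eq_of_integral_contDiff_smul_eq
    ((Lp.memLp (𝓕⁻ F : Lp ℂ 2 (volume : Measure ℝ))).locallyIntegrable (by norm_num))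
    (continuous_fourierInv_of_integrable hF).locallyIntegrable fun φ hφ hφc => ?_
  have hψc : HasCompactSupport (fun x => (φ x : ℂ)) := hφc.comp_left (g := ((↑) : ℝ → ℂ)) (by simp)
  have hψs : ContDiff ℝ ∞ (fun x => (φ x : ℂ)) := Complex.ofRealCLM.contDiff.comp hφ
  let ψ : 𝓢(ℝ, ℂ) := hψc.toSchwartzMap hψs
  have hψ : ∀ x, ψ x = (φ x : ℂ) := fun x => rfl
  have key := congrArg (fun u : 𝓢'(ℝ, ℂ) => u ψ) (Lp.fourierInv_toTemperedDistribution_eq F)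
  simp only [TemperedDistribution.fourierInv_apply, Lp.toTemperedDistribution_apply] at key
  calc ∫ x, φ x • (𝓕⁻ F : Lp ℂ 2 (volume : Measure ℝ)) x
      = ∫ x, ψ x • (𝓕⁻ F : Lp ℂ 2 (volume : Measure ℝ)) x := by simp [hψ]
    _ = ∫ x, (𝓕⁻ (ψ : ℝ → ℂ)) x • F x := by rw [← key, SchwartzMap.fourierInv_coe]
    _ = ∫ x, (𝓕 (ψ : ℝ → ℂ)) x • F (-x) := by
        rw [← integral_neg_eq_self]
        simp [Real.fourierInv_eq_fourier_neg]
    _ = ∫ x, ψ x • 𝓕 (fun x => F (-x)) x := by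
        simpa using! VectorFourier.integral_fourierIntegral_smul_eq_flip (L := innerₗ ℝ)
          Real.continuous_fourierChar continuous_inner ψ.integrable hF.comp_neg
    _ = ∫ x, φ x • 𝓕⁻ (F : ℝ → ℂ) x := by
        rw [Real.fourierInv_eq_fourier_comp_neg]; simp [hψ]

/-- A continuous bandlimited function is, at every point, the Fourier integral of an integrable
function on the band. The reflected transform `H ξ = F (-ξ)` is used, so that the inverse transform
of `F` becomes the forward transform of `H`. -/
theorem exists_integrable_fourier_eq {Ω : ℝ} {g : ℝ → ℂ} (hg : g ∈ PaleyWiener Ω)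
    (hgc : Continuous g) :
    ∃ H : ℝ → ℂ, Integrable H ∧ (∀ᵐ ξ : ℝ, Ω < |2 * Real.pi * ξ| → H ξ = 0) ∧ g = 𝓕 H := by
  obtain ⟨hgL, hsupp⟩ := hg
  set F : Lp ℂ 2 (volume : Measure ℝ) := 𝓕 (hgL.toLp g) with hF
  have hpi := Real.pi_pos
  let B : Set ℝ := Metric.closedBall 0 (Ω / (2 * Real.pi))
  -- A square integrable function that vanishes off a set of finite measure is integrable.
  have hFint : Integrable (F : ℝ → ℂ) := by
    have : IsFiniteMeasure (volume.restrict B) :=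
      ⟨by simpa using! measure_closedBall_lt_top⟩
    refine IntegrableOn.integrable_of_ae_notMem_eq_zero (s := B)
      (((Lp.memLp F).restrict B).integrable (by norm_num)) ?_
    filter_upwards [hsupp] with ξ hξ hξB
    refine hξ ?_
    rw [Metric.mem_closedBall, dist_zero_right, Real.norm_eq_abs, not_le,
      div_lt_iff₀ (by positivity)] at hξB
    rwa [abs_mul, abs_of_pos (by positivity : 0 < 2 * Real.pi), mul_comm]
  refine ⟨fun ξ => F (-ξ), hFint.comp_neg, ?_, ?_⟩
  · filter_upwards [(Measure.measurePreserving_neg (volume : Measure ℝ)).quasiMeasurePreserving.ae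
      hsupp] with ξ hξ h
    exact hξ (by rwa [mul_neg, abs_neg])
  · rw [← Real.fourierInv_eq_fourier_comp_neg]
    have hcont : Continuous (𝓕⁻ (F : ℝ → ℂ)) := continuous_fourierInv_of_integrable hFint
    refine Measure.eq_of_ae_eq (μ := volume) ?_ hgc hcont
    have hinv : 𝓕⁻ F = hgL.toLp g := FourierTransform.fourierInv_fourier_eq _
    have h := coeFn_fourierInv_ae_eq F hFint
    rw [hinv] at h
    exact hgL.coeFn_toLp.symm.trans h

/-! ### Iterated differences -/

theorem fwdDiff_fourier {H : ℝ → ℂ} (hH : Integrable H) (T : ℝ) :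
    fwdDiff T (𝓕 H) =
      𝓕 (fun ξ => Complex.exp ((-2 * Real.pi * ξ * T : ℝ) * Complex.I) * H ξ - H ξ) := by
  ext t
  have h1 := integrable_exp_ofReal_mul_I_mul hH
    (θ := fun ξ => -2 * Real.pi * ξ * (t + T)) (by fun_prop)
  have h2 := integrable_exp_ofReal_mul_I_mul hH (θ := fun ξ => -2 * Real.pi * ξ * t) (by fun_prop)
  simp only [fwdDiff, Real.fourier_real_eq_integral_exp_smul, smul_eq_mul]
  rw [← integral_sub h1 h2]
  congr 1
  ext ξ
  rw [mul_sub, ← mul_assoc (Complex.exp _) (Complex.exp _), ← Complex.exp_add]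
  push_cast
  ring_nf

/-- Each difference keeps the band and multiplies the uniform bound by `T * Ω`. -/
theorem norm_iterate_fwdDiff_fourier_le {Ω T : ℝ} (hΩ : 0 < Ω) (hT : 0 < T) (N : ℕ) {H : ℝ → ℂ}
    (hH : Integrable H) (hsupp : ∀ᵐ ξ : ℝ, Ω < |2 * Real.pi * ξ| → H ξ = 0) {C : ℝ}
    (hC : ∀ t, ‖𝓕 H t‖ ≤ C) (t : ℝ) : ‖(fwdDiff T)^[N] (𝓕 H) t‖ ≤ (T * Ω) ^ N * C := by
  induction N generalizing H C with
  | zero => simpa using hC t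
  | succ N ih =>
    have hstep : ∀ s, ‖fwdDiff T (𝓕 H) s‖ ≤ T * Ω * C := fun s => by
      have h := Convex.norm_image_sub_le_of_norm_deriv_le (f := 𝓕 H) (C := Ω * C) (s := univ)
        (fun x _ => by
          obtain ⟨d, hd, -⟩ := exists_hasDerivAt_fourier_norm_le hΩ hH hsupp hC x
          exact hd.differentiableAt)
        (fun x _ => by
          obtain ⟨d, hd, hdC⟩ := exists_hasDerivAt_fourier_norm_le hΩ hH hsupp hC x
          rwa [hd.deriv])
        convex_univ (mem_univ s) (mem_univ (s + T))
      rw [add_sub_cancel_left, Real.norm_of_nonneg hT.le] at h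
      exact h.trans_eq (by ring)
    rw [Function.iterate_succ_apply, pow_succ, mul_assoc]
    rw [fwdDiff_fourier hH T] at hstep ⊢
    refine ih ((integrable_exp_ofReal_mul_I_mul hH (by fun_prop)).sub hH) ?_ hstep
    filter_upwards [hsupp] with ξ hξ h
    simp [hξ h]

theorem iterDiff_samples (N : ℕ) (g : ℝ → ℂ) (T : ℝ) :
    iterDiff N (samples g T) = samples ((fwdDiff T)^[N] g) T := by
  induction N generalizing g with
  | zero => rfl
  | succ N ih =>
    have h : fwdDiff 1 (samples g T) = samples (fwdDiff T g) T := by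
      ext k
      simp [fwdDiff, samples, add_mul]
    rw [Function.iterate_succ_apply, ← ih, ← h]
    rfl

theorem lemma1 (Ω T : ℝ) (hT : 0 < T) (N : ℕ) (hN : 1 ≤ N) (g : ℝ → ℂ)
    (hg : g ∈ PaleyWiener Ω) (hgN : ContDiff ℝ N g) :
    BoundedFun g ∧ BoundedFun (iterDiff N (samples g T)) ∧
      supNorm (iterDiff N (samples g T)) ≤ (T * Ω) ^ N * supNorm g := by
  obtain ⟨H, hH, hsupp, rfl⟩ := exists_integrable_fourier_eq hg hgN.continuous
  have hbdd : BoundedFun (𝓕 H) := by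
    refine ⟨∫ ξ, ‖H ξ‖, ?_⟩
    rintro _ ⟨t, rfl⟩
    exact VectorFourier.norm_fourierIntegral_le_integral_norm _ _ _ _ _
  have hle : ∀ k, ‖iterDiff N (samples (𝓕 H) T) k‖ ≤ (T * Ω) ^ N * supNorm (𝓕 H) := by
    rcases lt_or_ge 0 Ω with hΩ | hΩ
    · intro k
      rw [iterDiff_samples]
      exact norm_iterate_fwdDiff_fourier_le hΩ hT N hH hsupp (fun t => le_ciSup hbdd t) _
    -- The band is empty or `{0}`, so `g = 0`; `(T * Ω) ^ N` may then be negative.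
    · have hH0 : H =ᵐ[volume] 0 := by
        filter_upwards [hsupp, Measure.ae_ne volume 0] with ξ hξ hξ0
        exact hξ (hΩ.trans_lt (by positivity))
      have h0 : 𝓕 H = 0 := by
        ext t
        rw [Real.fourier_congr_ae hH0, Real.fourier_real_eq]
        simp
      have hz : iterDiff N (samples 0 T) = 0 := by
        have : (fwdDiff T)^[N] (0 : ℝ → ℂ) = 0 :=
          Function.iterate_fixed (by ext; simp [fwdDiff]) N
        rw [iterDiff_samples, this]
        rfl
      intro k
      simp [h0, hz, supNorm]
  refine ⟨hbdd, ⟨(T * Ω) ^ N * supNorm (𝓕 H), ?_⟩, ciSup_le hle⟩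
  rintro _ ⟨k, rfl⟩
  exact hle k
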